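/- **Conventions.** A *graded graph* is a set $\Gamma=\bigsqcup_{k\ge 0}\Gamma_k$ with all $\Gamma_k$ finite, together with a multiplicity function $\kappa\colon\Gamma\times\Gamma\to\mathbb{R}_{\ge 0}$ such that $\kappa(\lambda,\mu)=0$ unless $|\mu|=|\lambda|+1$ (where $|\lambda|=k$ for $\lambda\in\Gamma_k$), and such that for every $\lambda$ there is $\mu$ with $\lambda\nearrow\mu$, i.e. $|\mu|=|\lambda|+1$ and $\kappa(\lambda,\mu)\neq 0$. It is a *branching graph* if $\Gamma_0=\{\varnothing\}$ is a singleton and every $\mu$ with $|\mu|\ge1$ has some $\lambda\nearrow\mu$. A *finite harmonic function* on $\Gamma$ is a function $\varphi\colon\Gamma\to\mathbb{R}_{\ge0}$ with $\varphi(\lambda)=\sum_{\mu:\lambda\nearrow\mu}\kappa(\lambda,\mu)\varphi(\mu)$ for all $\lambda$. It is *normalized* if $\varphi(\varnothing)=1$, and *indecomposable* if every harmonic function $\varphi'\le\varphi$ that is not identically zero is a constant multiple of $\varphi$. For a branching graph $\Gamma$, let $\operatorname{exFH}(\Gamma)$ be the set of finite normalized indecomposable harmonic functions on $\Gamma$,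 and $\operatorname{exFH}^{\circ}(\Gamma)$ the subset of strictly positive ones. The *direct product* $\Gamma_1\times\dots\times\Gamma_n$ of branching graphs has as vertices the tuples $\lambda=(\lambda_1,\dots,\lambda_n)$ with $|\lambda|=|\lambda_1|+\dots+|\lambda_n|$; the multiplicity from $\lambda$ to $\mu$ is $\kappa_i(\lambda_i,\mu_i)$ if $\lambda$ and $\mu$ differ exactly in the $i$-th coordinate, and $0$ otherwise. For a nonempty finite set $I$ put $\Delta_I^{0}=\{(w_i)_{i\in I}: w_i>0,\ \sum_{i\in I}w_i=1\}$, and $\Delta_n^0=\Delta_{\{1,\dots,n\}}^0$. **Proposition.** Let $n\ge1$ and let $\Gamma_1,\dots,\Gamma_n$ be branching graphs. 1. The map sending $(\varphi_1,\dots,\varphi_n,w)$ to $$\varphi(\lambda_1,\dots,\lambda_n)=\prod_{i=1}^n w_i^{|\lambda_i|}\varphi_i(\lambda_i)$$ is a bijection from $\operatorname{exFH}^{\circ}(\Gamma_1)\times\dots\times\operatorname{exFH}^{\circ}(\Gamma_n)\times\Delta_n^0$ onto $\operatorname{exFH}^{\circ}(\Gamma_1\times\dots\times\Gamma_n)$.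 2. The map sending $(I,w,(\varphi_i)_{i\in I})$ to $$\varphi(\lambda_1,\dots,\lambda_n)=\begin{cases}\prod_{i\in I}w_i^{|\lambda_i|}\varphi_i(\lambda_i), & \text{if }\lambda_j=\varnothing\text{ for all }j\in\{1,\dots,n\}\setminus I,\\ 0,&\text{otherwise,}\end{cases}$$ is a bijection from $\bigsqcup_{\varnothing\ne I\subset\{1,\dots,n\}}\Delta_I^{0}\times\prod_{i\in I}\operatorname{exFH}(\Gamma_i)$ onto $\operatorname{exFH}(\Gamma_1\times\dots\times\Gamma_n)$. In particular, for each $\varphi\in\operatorname{exFH}(\Gamma_1\times\dots\times\Gamma_n)$ the data $I$, $w$, $(\varphi_i)_{i\in I}$ exist and are unique. -/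

import Mathlib

universe u v

/-- A graded graph with vertex type `V`: every vertex has a level `rank`, every level is finite,
the multiplicities `κ` are nonnegative reals that vanish except from one level to the next, and
every vertex has an edge going up. -/
structure GradedGraph (V : Type u) where
  rank : V → ℕ
  finite_level : ∀ n, {x | rank x = n}.Finite
  κ : V → V → ℝ
  κ_nonneg : ∀ x y, 0 ≤ κ x y
  κ_eq_zero : ∀ x y, rank y ≠ rank x + 1 → κ x y = 0
  exists_up : ∀ x, ∃ y, rank y = rank x + 1 ∧ κ x y ≠ 0

/-- A branching graph: a graded graph whose level `0` is the singleton `{root}`, and in which every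
vertex of positive level has an edge coming from the preceding level. -/
structure BranchingGraph (V : Type u) extends GradedGraph V where
  root : V
  rank_eq_zero_iff : ∀ x, rank x = 0 ↔ x = root
  exists_down : ∀ y, 1 ≤ rank y → ∃ x, rank y = rank x + 1 ∧ κ x y ≠ 0

namespace GradedGraph

variable {V : Type u}

/-- The finite set of vertices of level `n`. -/
noncomputable def level (G : GradedGraph V) (n : ℕ) : Finset V := (G.finite_level n).toFinset

/-- `φ` is a finite harmonic function: it takes values in `[0, ∞)` and
`φ x = ∑ κ x y * φ y` over all `y` with an edge from `x` to `y`. All such `y` lie in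
the level following that of `x`, and the other vertices of that level contribute `0`. -/
def IsFiniteHarmonic (G : GradedGraph V) (φ : V → ℝ) : Prop :=
  (∀ x, 0 ≤ φ x) ∧ ∀ x, φ x = ∑ y ∈ G.level (G.rank x + 1), G.κ x y * φ y

/-- A finite harmonic function `φ` is indecomposable if every harmonic function `ψ ≤ φ` that is
not identically zero is a constant multiple of `φ`. (A harmonic function with values in `[0, ∞]`
that is bounded above by the finite function `φ` is finite.) -/
def IsIndecomposable (G : GradedGraph V) (φ : V → ℝ) : Prop :=
  ∀ ψ : V → ℝ, G.IsFiniteHarmonic ψ → (∃ x, ψ x ≠ 0) → (∀ x, ψ x ≤ φ x) →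
    ∃ c : ℝ, ∀ x, ψ x = c * φ x

end GradedGraph

namespace BranchingGraph

/-- The finite normalized indecomposable harmonic functions on a branching graph. -/
def exFH {V : Type u} (G : BranchingGraph V) : Set (V → ℝ) :=
  {φ | G.IsFiniteHarmonic φ ∧ φ G.root = 1 ∧ G.IsIndecomposable φ}

/-- The strictly positive finite normalized indecomposable harmonic functions. -/
def exFHPos {V : Type u} (G : BranchingGraph V) : Set (V → ℝ) :=
  {φ | φ ∈ G.exFH ∧ ∀ x, 0 < φ x}

variable {ι : Type v} [Fintype ι] {V : ι → Type u}

open Classical in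
/-- Multiplicities of the direct product. If `x` and `y` differ in exactly one coordinate `i`, this
is the multiplicity from `x i` to `y i`; otherwise it is `0`. (For `x = y` every summand
vanishes; if `x` and `y` differ exactly at `i`, only the `i`-th summand survives.) -/
noncomputable def prodκ (G : ∀ i, BranchingGraph (V i)) (x y : ∀ i, V i) : ℝ :=
  ∑ i, if ∀ j, j ≠ i → x j = y j then (G i).κ (x i) (y i) else 0

theorem prodκ_update [DecidableEq ι] (G : ∀ i, BranchingGraph (V i)) (x : ∀ i, V i) (i : ι)
    (a : V i) (h : x i ≠ a) : prodκ G x (Function.update x i a) = (G i).κ (x i) a := by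
  classical
  unfold prodκ
  rw [Finset.sum_eq_single i]
  · rw [if_pos]
    · simp
    · intro j hj
      simp [hj]
  · intro j _ hj
    rw [if_neg]
    intro hh
    have := hh i (Ne.symm hj)
    simp at this
    exact h this
  · simp

theorem rank_update [DecidableEq ι] (G : ∀ i, BranchingGraph (V i)) (x : ∀ i, V i) (i : ι)
    (a : V i) : ∑ j, (G j).rank (Function.update x i a j) + (G i).rank (x i)
      = ∑ j, (G j).rank (x j) + (G i).rank a := by
  rw [← Finset.add_sum_erase _ (fun j => (G j).rank (Function.update x i a j)) (Finset.mem_univ i),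
    ← Finset.add_sum_erase _ (fun j => (G j).rank (x j)) (Finset.mem_univ i)]
  have : ∑ j ∈ Finset.univ.erase i, (G j).rank (Function.update x i a j)
      = ∑ j ∈ Finset.univ.erase i, (G j).rank (x j) := by
    refine Finset.sum_congr rfl fun j hj => ?_
    rw [Function.update_of_ne (Finset.ne_of_mem_erase hj)]
  simp only [this, Function.update_self]
  omega

/-- The direct product of a nonempty finite family of branching graphs: vertices are tuples, the
level of a tuple is the sum of the levels of its coordinates, and multiplicities are `prodκ`. -/
noncomputable def prod [Nonempty ι] (G : ∀ i, BranchingGraph (V i)) :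
    BranchingGraph (∀ i, V i) where
  rank x := ∑ i, (G i).rank (x i)
  finite_level n := by
    refine (Set.Finite.pi' (t := fun i => {a : V i | (G i).rank a ≤ n}) fun i => ?_).subset ?_
    · refine ((Set.finite_Iic n).biUnion fun m _ => (G i).finite_level m).subset ?_
      intro a ha
      simpa using ha
    · intro x hx i
      rw [Set.mem_ofPred_eq] at hx ⊢
      rw [← hx]
      exact Finset.single_le_sum (f := fun i => (G i).rank (x i)) (fun _ _ => Nat.zero_le _)
        (Finset.mem_univ i)
  κ := prodκ G
  κ_nonneg x y := by
    refine Finset.sum_nonneg fun i _ => ?_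
    split_ifs
    · exact (G i).κ_nonneg _ _
    · exact le_rfl
  κ_eq_zero x y h := by
    classical
    refine Finset.sum_eq_zero fun i _ => ?_
    split_ifs with hi
    · refine (G i).κ_eq_zero _ _ fun hr => h ?_
      have hy : y = Function.update x i (y i) := by
        funext j
        by_cases hj : j = i
        · subst hj; simp
        · simp [hj, hi j hj]
      have := rank_update G x i (y i)
      rw [← hy] at this
      omega
    · rfl
  exists_up x := by
    classical
    obtain ⟨i⟩ := ‹Nonempty ι›
    obtain ⟨a, ha, hκ⟩ := (G i).exists_up (x i)
    refine ⟨Function.update x i a, ?_, ?_⟩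
    · have := rank_update G x i a
      omega
    · rwa [prodκ_update]
      rintro rfl
      omega
  root i := (G i).root
  rank_eq_zero_iff x := by
    simp [funext_iff, (G _).rank_eq_zero_iff]
  exists_down y hy := by
    classical
    obtain ⟨i, -, hi⟩ := Finset.exists_ne_zero_of_sum_ne_zero (Nat.one_le_iff_ne_zero.mp hy)
    obtain ⟨a, ha, hκ⟩ := (G i).exists_down (y i) (Nat.one_le_iff_ne_zero.mpr hi)
    have hne : y i ≠ a := by
      rintro rfl
      omega
    refine ⟨Function.update y i a, ?_, ?_⟩
    · have := rank_update G y i a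
      omega
    · have h := prodκ_update G (Function.update y i a) i (y i) (by simpa using hne.symm)
      simp only [Function.update_idem, Function.update_eq_self, Function.update_self] at h
      rwa [h]

/-- The function `x ↦ ∏ i, w i ^ |x i| * φ i (x i)` on the product. -/
def prodFun (G : ∀ i, BranchingGraph (V i)) (p : (∀ i, V i → ℝ) × (ι → ℝ)) (x : ∀ i, V i) : ℝ :=
  ∏ i, p.2 i ^ (G i).rank (x i) * p.1 i (x i)

/-- A subset `I` of the index set with weights and functions indexed by `I` only. -/
abbrev FaceData (V : ι → Type u) : Type (max u v) :=
  Σ I : Finset ι, (∀ i : I, V i → ℝ) × (I → ℝ)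

open Classical in
/-- The function on the product that equals `∏ i ∈ I, w i ^ |x i| * φ i (x i)` where all
coordinates outside `I` are roots, and `0` elsewhere. -/
noncomputable def faceFun (G : ∀ i, BranchingGraph (V i)) (p : FaceData V) (x : ∀ i, V i) : ℝ :=
  if ∀ j, j ∉ p.1 → x j = (G j).root then
    ∏ i : p.1, p.2.2 i ^ (G i).rank (x i) * p.2.1 i (x i)
  else 0

end BranchingGraph

/-- The open simplex: positive weights on `ι` with sum `1`. -/
def openSimplex (ι : Type v) [Fintype ι] : Set (ι → ℝ) :=
  {w | (∀ i, 0 < w i) ∧ ∑ i, w i = 1}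

/-!
Write `D i` for the operator `coordStep G i`, which applies the upward step of the `i`-th factor to
the `i`-th coordinate. The `D i` are positive, commute, and sum to the step operator of the product,
so the harmonic functions on the product are the nonnegative fixed points of `∑ i, D i`.

Call a normalized nonnegative eigenfunction of the step operator of a single factor extreme if it
dominates only its own multiples among the eigenfunctions with the same eigenvalue `w`
(`extremeEigen`). For `w > 0` these are the functions `w ^ rank * φ` with `φ ∈ exFH`; for `w = 0`
there is just one, the indicator function of the root. In these terms both claims follow from
`mem_exFH_prod_iff`: the elements of `exFH` of the product are the tensor products of extreme
eigenfunctions whose eigenvalues are nonnegative with sum `1`. The face `I` is the set of indices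
with a nonzero eigenvalue.

Let `φ` be indecomposable on the product. Each `D i φ` is harmonic and at most `φ`, so
`D i φ = w i • φ` (`exists_isJointEigen`). To see that the `i`-th slice `p` of `φ` through the root
is extreme when `w i > 0`, take a smaller eigenfunction `q`, multiply `φ` by `q / p` in the `i`-th
coordinate at a high level `N`, push the result down with `(w i)⁻¹ • D i`, and let `N` tend to
infinity along an ultrafilter. This gives a harmonic function below `φ` with slice `q`, so `q` is
a multiple of `p` (`IsJointEigen.exists_lift`). All parallel slices are dominated by multiples of
`p` (`IsJointEigen.exists_slice_le`), hence proportional to it, and `φ` is a tensor product.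

Conversely, let `ψ` be harmonic and at most a tensor product `Φ` of extreme eigenfunctions. A
compactness argument in the style of Choquet and Deny shows `D i ψ = w i • ψ`
(`isJointEigen_of_le`). Every slice of `ψ` is then an eigenfunction below a multiple of an extreme
one, so it is proportional to it, and `ψ` is a multiple of `Φ` (`IsJointEigen.eq_mul_tensor`).
-/

open Filter Topology

/-! ### The step operator of a graph and its eigenfunctions -/

namespace GradedGraph

variable {V : Type u}

/-- The weighted sum of a function over the upward neighbours of a vertex. Harmonic functions are
the fixed points of this operator. -/
noncomputable def step (G : GradedGraph V) (f : V → ℝ) (x : V) : ℝ :=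
  ∑ y ∈ G.level (G.rank x + 1), G.κ x y * f y

/-- A nonnegative function `f` with `step f = w • f`. -/
def IsEigen (G : GradedGraph V) (w : ℝ) (f : V → ℝ) : Prop :=
  (∀ x, 0 ≤ f x) ∧ ∀ x, G.step f x = w * f x

theorem mem_level (G : GradedGraph V) {n : ℕ} {x : V} : x ∈ G.level n ↔ G.rank x = n := by
  simp [level]

theorem isFiniteHarmonic_iff (G : GradedGraph V) (f : V → ℝ) :
    G.IsFiniteHarmonic f ↔ G.IsEigen 1 f := by
  simp only [IsFiniteHarmonic, IsEigen, step, one_mul, eq_comm]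

theorem step_mono (G : GradedGraph V) {f g : V → ℝ} (h : ∀ x, f x ≤ g x) (x : V) :
    G.step f x ≤ G.step g x :=
  Finset.sum_le_sum fun y _ => mul_le_mul_of_nonneg_left (h y) (G.κ_nonneg x y)

theorem step_const_mul (G : GradedGraph V) (c : ℝ) (f : V → ℝ) (x : V) :
    G.step (fun y => c * f y) x = c * G.step f x := by
  simp only [step, Finset.mul_sum]
  exact Finset.sum_congr rfl fun y _ => by ring

theorem step_nonneg (G : GradedGraph V) {f : V → ℝ} (h : ∀ x, 0 ≤ f x) (x : V) :
    0 ≤ G.step f x :=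
  Finset.sum_nonneg fun y _ => mul_nonneg (G.κ_nonneg x y) (h y)

theorem step_congr (G : GradedGraph V) {f g : V → ℝ} {x : V}
    (h : ∀ y, G.rank y = G.rank x + 1 → f y = g y) : G.step f x = G.step g x :=
  Finset.sum_congr rfl fun y hy => by rw [h y (G.mem_level.1 hy)]

theorem step_sum {α : Type*} (G : GradedGraph V) (s : Finset α) (f : α → V → ℝ) (x : V) :
    G.step (fun y => ∑ j ∈ s, f j y) x = ∑ j ∈ s, G.step (f j) x := by
  simp only [step, Finset.mul_sum]
  exact Finset.sum_comm

theorem step_tendsto {α : Type*} {l : Filter α} (G : GradedGraph V) {F : α → V → ℝ} {f : V → ℝ}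
    (h : ∀ y, Tendsto (fun n => F n y) l (𝓝 (f y))) (x : V) :
    Tendsto (fun n => G.step (F n) x) l (𝓝 (G.step f x)) :=
  tendsto_finsetSum _ fun y _ => (h y).const_mul _

theorem κ_mul_le_step (G : GradedGraph V) {f : V → ℝ} (h : ∀ x, 0 ≤ f x) {x y : V}
    (hy : G.rank y = G.rank x + 1) : G.κ x y * f y ≤ G.step f x :=
  Finset.single_le_sum (f := fun y => G.κ x y * f y)
    (fun y _ => mul_nonneg (G.κ_nonneg x y) (h y)) (G.mem_level.2 hy)

theorem step_pow_rank_mul (G : GradedGraph V) (w : ℝ) (f : V → ℝ) (x : V) :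
    G.step (fun y => w ^ G.rank y * f y) x = w ^ (G.rank x + 1) * G.step f x := by
  rw [← step_const_mul]
  exact G.step_congr fun y hy => by rw [hy]

theorem IsEigen.const_mul {G : GradedGraph V} {w c : ℝ} {f : V → ℝ} (h : G.IsEigen w f)
    (hc : 0 ≤ c) : G.IsEigen w fun x => c * f x :=
  ⟨fun x => mul_nonneg hc (h.1 x), fun x => by rw [step_const_mul, h.2]; ring⟩

/-- Multiplying by `v ^ rank` multiplies the eigenvalue by `v`. -/
theorem IsEigen.pow_rank_mul {G : GradedGraph V} {w v : ℝ} {f : V → ℝ} (h : G.IsEigen w f)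
    (hv : 0 ≤ v) : G.IsEigen (v * w) fun x => v ^ G.rank x * f x :=
  ⟨fun x => mul_nonneg (pow_nonneg hv _) (h.1 x), fun x => by
    rw [step_pow_rank_mul, h.2]; ring⟩

end GradedGraph

namespace BranchingGraph

section Single

variable {V : Type u} (G : BranchingGraph V)

/-- The normalized nonnegative `w`-eigenfunctions of `step` that are extreme: every smaller
nonnegative `w`-eigenfunction is a multiple. -/
def extremeEigen (w : ℝ) : Set (V → ℝ) :=
  {p | G.IsEigen w p ∧ p G.root = 1 ∧
    ∀ q, G.IsEigen w q → (∀ x, q x ≤ p x) → ∃ c : ℝ, ∀ x, q x = c * p x}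

theorem rank_root : G.rank G.root = 0 := (G.rank_eq_zero_iff _).2 rfl

/-- The zero function, excluded in `IsIndecomposable`, is the multiple by `0`. -/
theorem exFH_eq_extremeEigen : G.exFH = G.extremeEigen 1 := by
  ext φ
  simp only [exFH, extremeEigen, Set.mem_ofPred_eq, GradedGraph.isFiniteHarmonic_iff,
    GradedGraph.IsIndecomposable]
  refine and_congr_right fun _ => and_congr_right fun _ => ⟨fun h q hq hle => ?_,
    fun h q hq _ hle => h q hq hle⟩
  by_cases hz : ∃ x, q x ≠ 0
  · exact h q hq hz hle
  · push Not at hz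
    exact ⟨0, fun x => by simp [hz]⟩

/-- For the eigenvalue `0` nothing survives above the root. -/
theorem eq_zero_of_isEigen_zero {p : V → ℝ} (hp : G.IsEigen 0 p) {a : V} (ha : a ≠ G.root) :
    p a = 0 := by
  have hr : G.rank a ≠ 0 := fun h => ha ((G.rank_eq_zero_iff a).1 h)
  obtain ⟨b, hb, hκ⟩ := G.exists_down a (Nat.one_le_iff_ne_zero.2 hr)
  have h1 := G.κ_mul_le_step hp.1 hb
  rw [hp.2, zero_mul] at h1
  have h2 : G.κ b a * p a = 0 := le_antisymm h1 (mul_nonneg (G.κ_nonneg _ _) (hp.1 a))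
  exact (mul_eq_zero.1 h2).resolve_left hκ

theorem mem_extremeEigen_zero {p : V → ℝ} (hp : G.IsEigen 0 p) (h1 : p G.root = 1) :
    p ∈ G.extremeEigen 0 := by
  refine ⟨hp, h1, fun q hq _ => ⟨q G.root, fun x => ?_⟩⟩
  by_cases hx : x = G.root
  · rw [hx, h1, mul_one]
  · rw [G.eq_zero_of_isEigen_zero hp hx, G.eq_zero_of_isEigen_zero hq hx, mul_zero]

open Classical in
theorem extremeEigen_zero_eq : G.extremeEigen 0 = {fun a => if a = G.root then 1 else 0} := by
  ext p
  rw [Set.mem_singleton_iff]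
  constructor
  · intro hp
    funext a
    split_ifs with ha
    · rw [ha, hp.2.1]
    · exact G.eq_zero_of_isEigen_zero hp.1 ha
  · rintro rfl
    refine G.mem_extremeEigen_zero ⟨fun x => by positivity, fun x => ?_⟩ (if_pos rfl)
    rw [zero_mul]
    refine Finset.sum_eq_zero fun y hy => ?_
    have hy' := G.mem_level.1 hy
    have hne : y ≠ G.root := by
      rintro rfl
      rw [rank_root] at hy'
      omega
    simp [hne]

theorem pow_rank_mul_mem_extremeEigen {w v : ℝ} (hv : 0 < v) {p : V → ℝ}
    (hp : p ∈ G.extremeEigen w) : (fun x => v ^ G.rank x * p x) ∈ G.extremeEigen (v * w) := by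
  refine ⟨hp.1.pow_rank_mul hv.le, by simp [rank_root, hp.2.1], fun q hq hle => ?_⟩
  have hq' := hq.pow_rank_mul (inv_nonneg.2 hv.le)
  rw [inv_mul_cancel_left₀ hv.ne'] at hq'
  obtain ⟨c, hc⟩ := hp.2.2 _ hq' fun x => by
    rw [inv_pow, inv_mul_le_iff₀ (pow_pos hv _)]
    exact hle x
  refine ⟨c, fun x => ?_⟩
  have := hc x
  rw [inv_pow, inv_mul_eq_iff_eq_mul₀ (pow_pos hv _).ne'] at this
  rw [this]; ring

theorem pow_rank_mul_mem_extremeEigen_iff {w : ℝ} (hw : 0 < w) {p : V → ℝ} :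
    (fun x => w ^ G.rank x * p x) ∈ G.extremeEigen w ↔ p ∈ G.exFH := by
  rw [exFH_eq_extremeEigen]
  constructor
  · intro h
    have := G.pow_rank_mul_mem_extremeEigen (inv_pos.2 hw) h
    rw [inv_mul_cancel₀ hw.ne'] at this
    convert this using 2 with x
    rw [inv_pow, inv_mul_cancel_left₀ (pow_pos hw _).ne']
  · intro h
    simpa using G.pow_rank_mul_mem_extremeEigen hw h

end Single

end BranchingGraph

/-! ### Coordinate steps on a product -/

namespace BranchingGraph

section CoordStep

variable {ι : Type v} [DecidableEq ι] {V : ι → Type u} (G : ∀ i, BranchingGraph (V i))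

/-- The `step` operator of the `i`-th factor, acting on the `i`-th coordinate. -/
noncomputable def coordStep (i : ι) (f : (∀ j, V j) → ℝ) (x : ∀ j, V j) : ℝ :=
  (G i).step (fun a => f (Function.update x i a)) (x i)

/-- A nonnegative function on the product that is an eigenfunction of every `coordStep`, with
eigenvalue `w i` in the `i`-th coordinate. -/
def IsJointEigen (w : ι → ℝ) (f : (∀ j, V j) → ℝ) : Prop :=
  (∀ x, 0 ≤ f x) ∧ ∀ i x, coordStep G i f x = w i * f x

theorem coordStep_mono (i : ι) {f g : (∀ j, V j) → ℝ} (h : ∀ x, f x ≤ g x) (x : ∀ j, V j) :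
    coordStep G i f x ≤ coordStep G i g x :=
  (G i).step_mono (fun _ => h _) _

theorem coordStep_const_mul (i : ι) (c : ℝ) (f : (∀ j, V j) → ℝ) (x : ∀ j, V j) :
    coordStep G i (fun y => c * f y) x = c * coordStep G i f x :=
  (G i).step_const_mul c _ _

theorem coordStep_nonneg (i : ι) {f : (∀ j, V j) → ℝ} (h : ∀ x, 0 ≤ f x) (x : ∀ j, V j) :
    0 ≤ coordStep G i f x :=
  (G i).step_nonneg (fun _ => h _) _

theorem coordStep_sum {α : Type*} (i : ι) (s : Finset α) (f : α → (∀ j, V j) → ℝ)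
    (x : ∀ j, V j) :
    coordStep G i (fun y => ∑ j ∈ s, f j y) x = ∑ j ∈ s, coordStep G i (f j) x :=
  (G i).step_sum s (fun j a => f j (Function.update x i a)) _

theorem coordStep_tendsto {α : Type*} {l : Filter α} (i : ι) {F : α → (∀ j, V j) → ℝ}
    {f : (∀ j, V j) → ℝ} (h : ∀ y, Tendsto (fun n => F n y) l (𝓝 (f y))) (x : ∀ j, V j) :
    Tendsto (fun n => coordStep G i (F n) x) l (𝓝 (coordStep G i f x)) :=
  (G i).step_tendsto (fun _ => h _) _

theorem continuous_coordStep (i : ι) (x : ∀ j, V j) :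
    Continuous fun f : (∀ j, V j) → ℝ => coordStep G i f x :=
  continuous_finsetSum _ fun _ _ => (continuous_apply _).const_mul _

theorem coordStep_comm (i j : ι) (f : (∀ j, V j) → ℝ) (x : ∀ j, V j) :
    coordStep G i (coordStep G j f) x = coordStep G j (coordStep G i f) x := by
  rcases eq_or_ne i j with rfl | hij
  · rfl
  simp only [coordStep, GradedGraph.step, Function.update_of_ne hij, Function.update_of_ne hij.symm,
    Finset.mul_sum]
  rw [Finset.sum_comm]
  refine Finset.sum_congr rfl fun a _ => Finset.sum_congr rfl fun b _ => ?_
  rw [Function.update_comm hij]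
  ring

/-- Along the `i`-th coordinate a joint eigenfunction is an eigenfunction of the `i`-th factor. -/
theorem IsJointEigen.slice {w : ι → ℝ} {f : (∀ j, V j) → ℝ} (h : IsJointEigen G w f) (i : ι)
    (x : ∀ j, V j) : (G i).IsEigen (w i) fun a => f (Function.update x i a) :=
  ⟨fun _ => h.1 _, fun a => by
    simpa [coordStep] using h.2 i (Function.update x i a)⟩

/-- If a slice of a joint eigenfunction is dominated by a multiple of an extreme eigenfunction `p`,
then it is proportional to `p`. -/
theorem IsJointEigen.slice_eq {w : ι → ℝ} {f : (∀ j, V j) → ℝ} (h : IsJointEigen G w f) {i : ι}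
    {p : V i → ℝ} (hp : p ∈ (G i).extremeEigen (w i)) {x : ∀ j, V j} {C : ℝ}
    (hC : ∀ a, f (Function.update x i a) ≤ C * p a) (a : V i) :
    f (Function.update x i a) = p a * f (Function.update x i (G i).root) := by
  have hD : 0 < max C 1 := lt_max_of_lt_right one_pos
  obtain ⟨c, hc⟩ := hp.2.2 _ ((h.slice G i x).const_mul (inv_nonneg.2 hD.le)) fun b => by
    rw [inv_mul_le_iff₀ hD]
    exact (hC b).trans (mul_le_mul_of_nonneg_right (le_max_left _ _) (hp.1.1 b))
  have h1 := hc (G i).root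
  have h2 := hc a
  rw [hp.2.1, mul_one, inv_mul_eq_iff_eq_mul₀ hD.ne'] at h1
  rw [inv_mul_eq_iff_eq_mul₀ hD.ne'] at h2
  rw [h1, h2]
  ring

theorem coordStep_eq_zero_of_le {w : ι → ℝ} {Φ : (∀ i, V i) → ℝ} (hΦ : IsJointEigen G w Φ)
    {ψ : (∀ i, V i) → ℝ} (hψ : ∀ x, 0 ≤ ψ x ∧ ψ x ≤ Φ x) {i : ι} (hi : w i = 0)
    (x : ∀ i, V i) : coordStep G i ψ x = 0 := by
  refine le_antisymm ?_ (coordStep_nonneg G i (fun y => (hψ y).1) x)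
  have := coordStep_mono G i (fun y => (hψ y).2) x
  rwa [hΦ.2, hi, zero_mul] at this

/-- Lift of an eigenfunction `q` below the root slice of `φ` to a joint eigenfunction below `φ`:
multiply `φ` by the ratio of `q` to the root slice in the `i`-th coordinate, carry this function from
level `N` of the `i`-th factor down to the lower levels by the normalized step, and pass to a limit
in `N`. -/
theorem IsJointEigen.exists_lift {w : ι → ℝ} {φ : (∀ j, V j) → ℝ} (h : IsJointEigen G w φ)
    {i : ι} (hi : 0 < w i) {q : V i → ℝ} (hq : (G i).IsEigen (w i) q)
    (hle : ∀ a, q a ≤ φ (Function.update (fun j => (G j).root) i a)) :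
    ∃ ψ, IsJointEigen G w ψ ∧ (∀ x, ψ x ≤ φ x) ∧
      ∀ a, ψ (Function.update (fun j => (G j).root) i a) = q a := by
  set p : V i → ℝ := fun a => φ (Function.update (fun j => (G j).root) i a) with hp
  have hp0 : ∀ a, 0 ≤ p a := fun a => h.1 _
  -- Where `p` vanishes so does `q`, and the junk value `q a / 0 = 0` is the right one.
  have hratio : ∀ a, q a / p a * p a = q a := fun a => by
    rcases eq_or_ne (p a) 0 with h0 | h0
    · rw [h0, mul_zero]
      exact le_antisymm (hq.1 a) (h0 ▸ hle a)
    · exact div_mul_cancel₀ _ h0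
  set T : ((∀ j, V j) → ℝ) → (∀ j, V j) → ℝ := fun f x => (w i)⁻¹ * coordStep G i f x with hT
  set H : ℕ → (∀ j, V j) → ℝ := fun k => T^[k] fun x => q (x i) / p (x i) * φ x with hH
  have hsucc : ∀ k, H (k + 1) = T (H k) := fun k => Function.iterate_succ_apply' T k _
  have hbound : ∀ k x, H k x ∈ Set.Icc 0 (φ x) := by
    intro k
    induction k with
    | zero =>
      exact fun x => ⟨mul_nonneg (div_nonneg (hq.1 _) (hp0 _)) (h.1 x),
        mul_le_of_le_one_left (h.1 x) (div_le_one_of_le₀ (hle _) (hp0 _))⟩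
    | succ k ih =>
      intro x
      rw [hsucc]
      refine ⟨mul_nonneg (inv_nonneg.2 hi.le) (coordStep_nonneg G i (fun y => (ih y).1) x), ?_⟩
      rw [hT, inv_mul_le_iff₀ hi, ← h.2]
      exact coordStep_mono G i (fun y => (ih y).2) x
  have hother : ∀ j, j ≠ i → ∀ k x, coordStep G j (H k) x = w j * H k x := by
    intro j hj k
    induction k with
    | zero =>
      intro x
      simp only [hH, Function.iterate_zero, id, coordStep, Function.update_of_ne hj.symm]
      rw [GradedGraph.step_const_mul]
      have := h.2 j x
      rw [coordStep] at this
      rw [this]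
      ring
    | succ k ih =>
      intro x
      rw [hsucc, hT, coordStep_const_mul, coordStep_comm, funext ih, coordStep_const_mul]
      ring
  have hline : ∀ k a, H k (Function.update (fun j => (G j).root) i a) = q a := by
    intro k
    induction k with
    | zero => intro a; simpa [hH] using hratio a
    | succ k ih =>
      intro a
      rw [hsucc]
      simp only [hT, coordStep, Function.update_idem, Function.update_self, ih]
      rw [hq.2, inv_mul_cancel_left₀ hi.ne']
  -- The number of steps down to `x` from level `N` depends on `x i`, which makes `Ψ N` an
  -- eigenfunction below level `N`; above it the truncated subtraction only has to keep the bounds.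
  set Ψ : ℕ → (∀ j, V j) → ℝ := fun N x => H (N - (G i).rank (x i)) x with hΨ
  have hΨi : ∀ x, ∀ N, (G i).rank (x i) < N → coordStep G i (Ψ N) x = w i * Ψ N x := by
    intro x N hN
    obtain ⟨k, hk⟩ : ∃ k, N - (G i).rank (x i) = k + 1 := ⟨N - (G i).rank (x i) - 1, by omega⟩
    have h1 : Ψ N x = (w i)⁻¹ * coordStep G i (H k) x := by rw [hΨ]; simp only [hk, hsucc, hT]
    rw [h1, mul_inv_cancel_left₀ hi.ne']
    refine (G i).step_congr fun b hb => ?_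
    have : N - (G i).rank b = k := by omega
    simp only [hΨ, Function.update_self, this]
  have hΨj : ∀ j, j ≠ i → ∀ N x, coordStep G j (Ψ N) x = w j * Ψ N x := by
    intro j hj N x
    rw [hΨ]
    simp only [← hother j hj]
    simp only [coordStep, Function.update_of_ne hj.symm]
  have hK : IsCompact (Set.univ.pi fun x : ∀ i, V i => Set.Icc 0 (φ x)) :=
    isCompact_univ_pi fun _ => isCompact_Icc
  obtain ⟨ψ, hψ, hlim⟩ := hK.ultrafilter_le_nhds' ((hyperfilter ℕ).map Ψ)
    (Ultrafilter.mem_map.2 (Filter.univ_mem' fun _ x _ => hbound _ x))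
  have hlim' : ∀ x, Tendsto (fun N => Ψ N x) (hyperfilter ℕ : Filter ℕ) (𝓝 (ψ x)) :=
    tendsto_pi_nhds.1 hlim
  have hcof : ∀ m : ℕ, ∀ᶠ N in (hyperfilter ℕ : Filter ℕ), m < N := fun m =>
    Nat.hyperfilter_le_atTop (eventually_gt_atTop m)
  refine ⟨ψ, ⟨fun x => (hψ x trivial).1, fun j x => ?_⟩, fun x => (hψ x trivial).2, fun a => ?_⟩
  · refine tendsto_nhds_unique_of_eventuallyEq (coordStep_tendsto G j hlim' x)
      ((hlim' x).const_mul (w j)) ?_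
    rcases eq_or_ne j i with rfl | hj
    · exact (hcof _).mono fun N hN => hΨi x N hN
    · exact Filter.Eventually.of_forall fun N => hΨj j hj N x
  · refine tendsto_nhds_unique (hlim' _) ?_
    simp only [hΨ, hline]
    exact tendsto_const_nhds

variable [Fintype ι]

/-- A function from which each coordinate splits off is a tensor product up to its value at the
root. -/
theorem eq_prod_mul_root {f : (∀ j, V j) → ℝ} {p : ∀ i, V i → ℝ}
    (h : ∀ i x, f x = p i (x i) * f (Function.update x i (G i).root)) (x : ∀ j, V j) :
    f x = (∏ i, p i (x i)) * f fun i => (G i).root := by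
  have key : ∀ s : Finset ι, f x = (∏ i ∈ s, p i (x i)) *
      f (fun i => if i ∈ s then (G i).root else x i) := by
    intro s
    induction s using Finset.induction_on with
    | empty => simp
    | insert i s his ih =>
      rw [ih, h i, Finset.prod_insert his]
      have : Function.update (fun i => if i ∈ s then (G i).root else x i) i (G i).root =
          fun j => if j ∈ insert i s then (G j).root else x j := by
        funext j
        rcases eq_or_ne j i with rfl | hj
        · simp
        · simp [hj]
      rw [this, if_neg his]
      ring
  simpa using key Finset.univ

/-- The tensor product of a family of functions on the factors. -/
def tensor (p : ∀ i, V i → ℝ) (x : ∀ i, V i) : ℝ := ∏ i, p i (x i)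

theorem tensor_update (p : ∀ i, V i → ℝ) (x : ∀ i, V i) (i : ι) (a : V i) :
    tensor p (Function.update x i a) = p i a * ∏ j ∈ Finset.univ.erase i, p j (x j) := by
  rw [tensor, ← Finset.mul_prod_erase _ _ (Finset.mem_univ i), Function.update_self]
  congr 1
  refine Finset.prod_congr rfl fun j hj => ?_
  rw [Function.update_of_ne (Finset.ne_of_mem_erase hj)]

theorem tensor_update_root {p : ∀ i, V i → ℝ} (hp : ∀ i, p i (G i).root = 1) (i : ι) (a : V i) :
    tensor p (Function.update (fun j => (G j).root) i a) = p i a := by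
  simp [tensor_update, hp]

theorem isJointEigen_tensor {w : ι → ℝ} {p : ∀ i, V i → ℝ}
    (hp : ∀ i, (G i).IsEigen (w i) (p i)) : IsJointEigen G w (tensor p) := by
  refine ⟨fun x => Finset.prod_nonneg fun i _ => (hp i).1 _, fun i x => ?_⟩
  have h := tensor_update p x i (x i)
  rw [Function.update_eq_self] at h
  simp only [coordStep, tensor_update, h]
  simp only [mul_comm (p i _)]
  rw [GradedGraph.step_const_mul, (hp i).2]
  ring

/-- A joint eigenfunction below a tensor product of extreme eigenfunctions is a multiple of it. -/
theorem IsJointEigen.eq_mul_tensor {w : ι → ℝ} {p : ∀ i, V i → ℝ}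
    (hp : ∀ i, p i ∈ (G i).extremeEigen (w i)) {f : (∀ j, V j) → ℝ} (hf : IsJointEigen G w f)
    (hle : ∀ x, f x ≤ tensor p x) (x : ∀ j, V j) :
    f x = f (fun i => (G i).root) * tensor p x := by
  rw [mul_comm]
  refine eq_prod_mul_root G (fun i x => ?_) x
  have := hf.slice_eq G (hp i) (x := x) (C := ∏ j ∈ Finset.univ.erase i, p j (x j))
    (fun a => (hle _).trans_eq (by rw [tensor_update, mul_comm])) (x i)
  rwa [Function.update_eq_self] at this

theorem sum_coordStep_coordStep {f : (∀ j, V j) → ℝ} (h : ∀ x, ∑ i, coordStep G i f x = f x)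
    (j : ι) (x : ∀ j, V j) : ∑ i, coordStep G i (coordStep G j f) x = coordStep G j f x := by
  simp only [coordStep_comm G _ j]
  rw [← coordStep_sum]
  simp only [h]

variable [Nonempty ι]

/-- An edge of the product changes exactly one coordinate, along an edge of that factor. -/
theorem prod_step (f : (∀ j, V j) → ℝ) (x : ∀ j, V j) :
    (prod G).step f x = ∑ i, coordStep G i f x := by
  classical
  have hκ : ∀ y, (prod G).κ x y = prodκ G x y := fun _ => rfl
  have hr : ∀ y, (prod G).rank y = ∑ i, (G i).rank (y i) := fun _ => rfl
  simp only [GradedGraph.step, hκ, prodκ, Finset.sum_mul, coordStep]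
  rw [Finset.sum_comm]
  refine Finset.sum_congr rfl fun i _ => ?_
  simp only [ite_mul, zero_mul]
  rw [← Finset.sum_filter]
  have hup : ∀ y : ∀ j, V j, (∀ j, j ≠ i → x j = y j) → Function.update x i (y i) = y := by
    intro y hy
    funext j
    rcases eq_or_ne j i with rfl | hj
    · simp
    · simp [hj, hy j hj]
  refine Finset.sum_nbij' (fun y => y i) (fun a => Function.update x i a) ?_ ?_ ?_ ?_ ?_
  · intro y hy
    rw [Finset.mem_filter, GradedGraph.mem_level, hr, hr] at hy
    rw [GradedGraph.mem_level]
    have := rank_update G x i (y i)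
    rw [hup y hy.2] at this
    omega
  · intro a ha
    rw [GradedGraph.mem_level] at ha
    rw [Finset.mem_filter, GradedGraph.mem_level, hr, hr]
    have := rank_update G x i a
    refine ⟨by omega, fun j hj => by rw [Function.update_of_ne hj]⟩
  · intro y hy
    exact hup y (Finset.mem_filter.1 hy).2
  · intro a _
    simp
  · intro y hy
    rw [hup y (Finset.mem_filter.1 hy).2]

theorem isEigen_one_prod_iff (f : (∀ j, V j) → ℝ) :
    (prod G).IsEigen 1 f ↔ (∀ x, 0 ≤ f x) ∧ ∀ x, ∑ i, coordStep G i f x = f x := by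
  simp only [GradedGraph.IsEigen, prod_step, one_mul]

theorem IsJointEigen.isEigen_one {w : ι → ℝ} (hw : ∑ i, w i = 1) {f : (∀ j, V j) → ℝ}
    (h : IsJointEigen G w f) : (prod G).IsEigen 1 f := by
  rw [isEigen_one_prod_iff]
  refine ⟨h.1, fun x => ?_⟩
  simp only [h.2]
  rw [← Finset.sum_mul, hw, one_mul]

end CoordStep

end BranchingGraph

/-! ### Indecomposable harmonic functions on a product -/

namespace BranchingGraph

section Structure

variable {ι : Type v} [DecidableEq ι] [Fintype ι] {V : ι → Type u} (G : ∀ i, BranchingGraph (V i))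

/-- The harmonic functions on the product lying between `0` and `Φ`. -/
def harmonicBelow (Φ : (∀ i, V i) → ℝ) : Set ((∀ i, V i) → ℝ) :=
  {ψ | (∀ x, 0 ≤ ψ x ∧ ψ x ≤ Φ x) ∧ ∀ x, ∑ i, coordStep G i ψ x = ψ x}

theorem isCompact_harmonicBelow (Φ : (∀ i, V i) → ℝ) : IsCompact (harmonicBelow G Φ) := by
  have hK : IsCompact (Set.univ.pi fun x : ∀ i, V i => Set.Icc 0 (Φ x)) :=
    isCompact_univ_pi fun _ => isCompact_Icc
  refine hK.of_isClosed_subset ?_ fun ψ hψ x _ => hψ.1 x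
  simp only [harmonicBelow, Set.ofPred_and, Set.ofPred_forall]
  refine IsClosed.inter (isClosed_iInter fun x => ?_) (isClosed_iInter fun x => ?_)
  · exact (isClosed_le continuous_const (continuous_apply x)).inter
      (isClosed_le (continuous_apply x) continuous_const)
  · exact isClosed_eq (continuous_finsetSum _ fun i _ => continuous_coordStep G i x)
      (continuous_apply x)

/-- The normalized step `ψ ↦ (w i)⁻¹ • coordStep i ψ` preserves the harmonic functions below a joint
eigenfunction. -/
theorem inv_mul_coordStep_mem_harmonicBelow {w : ι → ℝ} {Φ : (∀ i, V i) → ℝ}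
    (hΦ : IsJointEigen G w Φ) {ψ : (∀ i, V i) → ℝ} (hψ : ψ ∈ harmonicBelow G Φ) {i : ι}
    (hi : 0 < w i) : (fun x => (w i)⁻¹ * coordStep G i ψ x) ∈ harmonicBelow G Φ := by
  refine ⟨fun x => ⟨mul_nonneg (inv_nonneg.2 hi.le)
    (coordStep_nonneg G i (fun y => (hψ.1 y).1) x), ?_⟩, fun x => ?_⟩
  · rw [inv_mul_le_iff₀ hi, ← hΦ.2]
    exact coordStep_mono G i (fun y => (hψ.1 y).2) x
  · simp only [coordStep_const_mul]
    rw [← Finset.mul_sum, sum_coordStep_coordStep G hψ.2]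

/-- The one-sided estimate behind `isJointEigen_of_le`. The defect `w i * ψ x - coordStep i ψ x`
attains its maximum `M` over the compact set `harmonicBelow G Φ`. Since a maximizer is a convex
combination of its images under the normalized steps, these images are again maximizers; summing the
defects along the iterates of the `i`-th normalized step telescopes, so all multiples of `M` stay
below `w i * Φ x`. -/
theorem mul_le_coordStep {w : ι → ℝ} (hw : ∀ i, 0 ≤ w i) (hw1 : ∑ i, w i = 1)
    {Φ : (∀ i, V i) → ℝ} (hΦ : IsJointEigen G w Φ) {ψ : (∀ i, V i) → ℝ}
    (hψ : ψ ∈ harmonicBelow G Φ) (i : ι) (x : ∀ i, V i) : w i * ψ x ≤ coordStep G i ψ x := by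
  rcases (hw i).eq_or_lt with hi | hi
  · rw [← hi, zero_mul]
    exact coordStep_nonneg G i (fun y => (hψ.1 y).1) x
  set F : ((∀ i, V i) → ℝ) → ℝ := fun f => w i * f x - coordStep G i f x with hF
  have hFmul : ∀ c f, F (fun y => c * f y) = c * F f := fun c f => by
    simp only [hF, coordStep_const_mul]; ring
  have hFc : Continuous F :=
    ((continuous_apply x).const_mul _).sub (continuous_coordStep G i x)
  obtain ⟨f, hf, hmax⟩ := (isCompact_harmonicBelow G Φ).exists_isMaxOn ⟨ψ, hψ⟩ hFc.continuousOn
  have hM : ∀ g ∈ harmonicBelow G Φ, F g ≤ F f := fun g hg => hmax hg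
  have hstep : ∀ g ∈ harmonicBelow G Φ, ∀ j, F (coordStep G j g) ≤ w j * F f := by
    intro g hg j
    rcases (hw j).eq_or_lt with hj | hj
    · have : coordStep G j g = fun y => 0 * g y := by
        funext y
        rw [coordStep_eq_zero_of_le G hΦ hg.1 hj.symm, zero_mul]
      rw [this, hFmul, ← hj, zero_mul, zero_mul]
    · have := hM _ (inv_mul_coordStep_mem_harmonicBelow G hΦ hg hj)
      rwa [hFmul, inv_mul_le_iff₀ hj] at this
  have hnext : ∀ g ∈ harmonicBelow G Φ, F g = F f →
      F (fun y => (w i)⁻¹ * coordStep G i g y) = F f := by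
    intro g hg hgf
    refine le_antisymm (hM _ (inv_mul_coordStep_mem_harmonicBelow G hΦ hg hi)) ?_
    rw [hFmul, le_inv_mul_iff₀ hi]
    have hsum : F g = ∑ j, F (coordStep G j g) := by
      simp only [hF, Finset.sum_sub_distrib, ← Finset.mul_sum, hg.2]
      rw [← sum_coordStep_coordStep G hg.2 i x]
      exact congrArg _ (Finset.sum_congr rfl fun j _ => coordStep_comm G j i g x)
    rw [← Finset.add_sum_erase _ _ (Finset.mem_univ i)] at hsum hw1
    have hrest : ∑ j ∈ Finset.univ.erase i, F (coordStep G j g) ≤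
        (∑ j ∈ Finset.univ.erase i, w j) * F f := by
      rw [Finset.sum_mul]
      exact Finset.sum_le_sum fun j _ => hstep g hg j
    have : (∑ j ∈ Finset.univ.erase i, w j) * F f = F f - w i * F f := by
      rw [eq_sub_of_add_eq' hw1]; ring
    linarith
  have htel : ∀ n : ℕ, ∀ g ∈ harmonicBelow G Φ, F g = F f → n * F f ≤ w i * g x := by
    intro n
    induction n with
    | zero =>
      intro g hg _
      simpa using mul_nonneg hi.le (hg.1 x).1
    | succ n ih =>
      intro g hg hgf
      have h1 := ih _ (inv_mul_coordStep_mem_harmonicBelow G hΦ hg hi) (hnext g hg hgf)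
      simp only [mul_inv_cancel_left₀ hi.ne'] at h1
      have h2 : w i * g x - coordStep G i g x = F f := hgf
      push_cast
      linarith
  have hM0 : F f ≤ 0 := by
    by_contra! hpos
    obtain ⟨n, hn⟩ := Archimedean.arch (w i * f x + 1) hpos
    have := htel n f hf rfl
    rw [nsmul_eq_mul] at hn
    linarith
  have : w i * ψ x - coordStep G i ψ x ≤ 0 := (hM ψ hψ).trans hM0
  linarith

/-- A Choquet–Deny type theorem: a harmonic function below a joint eigenfunction is itself a joint
eigenfunction, with the same eigenvalues. -/
theorem isJointEigen_of_le {w : ι → ℝ} (hw : ∀ i, 0 ≤ w i) (hw1 : ∑ i, w i = 1)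
    {Φ : (∀ i, V i) → ℝ} (hΦ : IsJointEigen G w Φ) {ψ : (∀ i, V i) → ℝ}
    (hψ : ψ ∈ harmonicBelow G Φ) : IsJointEigen G w ψ := by
  refine ⟨fun x => (hψ.1 x).1, fun i x => ?_⟩
  have hle := fun j => mul_le_coordStep G hw hw1 hΦ hψ j x
  have hsum : ∑ j, w j * ψ x = ∑ j, coordStep G j ψ x := by
    rw [hψ.2, ← Finset.sum_mul, hw1, one_mul]
  exact ((Finset.sum_eq_sum_iff_of_le fun j _ => hle j).1 hsum i (Finset.mem_univ i)).symm

theorem tensor_mem_exFH [Nonempty ι] {w : ι → ℝ} (hw : ∀ i, 0 ≤ w i) (hw1 : ∑ i, w i = 1)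
    {p : ∀ i, V i → ℝ} (hp : ∀ i, p i ∈ (G i).extremeEigen (w i)) :
    tensor p ∈ (prod G).exFH := by
  have hΦ : IsJointEigen G w (tensor p) := isJointEigen_tensor G fun i => (hp i).1
  rw [exFH_eq_extremeEigen]
  refine ⟨hΦ.isEigen_one G hw1, Finset.prod_eq_one fun i _ => (hp i).2.1, fun q hq hle => ?_⟩
  rw [isEigen_one_prod_iff] at hq
  exact ⟨_, (isJointEigen_of_le G hw hw1 hΦ
    ⟨fun x => ⟨hq.1 x, hle x⟩, hq.2⟩).eq_mul_tensor G hp hle⟩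

theorem exists_isJointEigen [Nonempty ι] {φ : (∀ i, V i) → ℝ} (hφ : φ ∈ (prod G).exFH) :
    ∃ w : ι → ℝ, (∀ i, 0 ≤ w i) ∧ ∑ i, w i = 1 ∧ IsJointEigen G w φ := by
  rw [exFH_eq_extremeEigen] at hφ
  obtain ⟨hE, h1, hext⟩ := hφ
  rw [isEigen_one_prod_iff] at hE
  have key : ∀ i, ∃ c : ℝ, ∀ x, coordStep G i φ x = c * φ x := fun i => by
    refine hext _ ((isEigen_one_prod_iff G _).2 ⟨coordStep_nonneg G i hE.1,
      sum_coordStep_coordStep G hE.2 i⟩) fun x => ?_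
    rw [← hE.2 x]
    exact Finset.single_le_sum (f := fun j => coordStep G j φ x)
      (fun j _ => coordStep_nonneg G j hE.1 x) (Finset.mem_univ i)
  choose w hw using key
  have hroot : ∀ i, w i = coordStep G i φ (prod G).root := fun i => by rw [hw, h1, mul_one]
  refine ⟨w, fun i => ?_, ?_, hE.1, hw⟩
  · rw [hroot]
    exact coordStep_nonneg G i hE.1 _
  · simp only [hroot]
    rw [hE.2, h1]

/-- Every slice of a joint eigenfunction is dominated by a multiple of the slice through the root:
move the other coordinates down to their roots one edge at a time. -/
theorem IsJointEigen.exists_slice_le {w : ι → ℝ} {f : (∀ j, V j) → ℝ} (h : IsJointEigen G w f)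
    (i : ι) (x : ∀ j, V j) : ∃ C : ℝ, ∀ a,
      f (Function.update x i a) ≤ C * f (Function.update (fun j => (G j).root) i a) := by
  induction hn : ∑ j, (G j).rank (x j) using Nat.strong_induction_on generalizing x with
  | _ n ih =>
  by_cases hx : ∃ j, j ≠ i ∧ x j ≠ (G j).root
  · obtain ⟨j, hji, hj⟩ := hx
    have hr : (G j).rank (x j) ≠ 0 := fun h => hj (((G j).rank_eq_zero_iff _).1 h)
    obtain ⟨b, hb, hκ⟩ := (G j).exists_down (x j) (Nat.one_le_iff_ne_zero.2 hr)
    have hrank := rank_update G x j b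
    obtain ⟨C, hC⟩ := ih _ (by omega) (Function.update x j b) rfl
    have hκ0 : 0 < (G j).κ b (x j) := lt_of_le_of_ne ((G j).κ_nonneg _ _) hκ.symm
    refine ⟨((G j).κ b (x j))⁻¹ * (|w j| * C), fun a => ?_⟩
    have h2 := (G j).toGradedGraph.κ_mul_le_step (h.slice G j (Function.update x i a)).1 hb
    rw [(h.slice G j (Function.update x i a)).2 b] at h2
    have h3 : Function.update (Function.update x i a) j (x j) = Function.update x i a := by
      rw [Function.update_comm hji.symm, Function.update_eq_self]
    simp only [h3, Function.update_comm hji.symm] at h2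
    rw [mul_assoc, le_inv_mul_iff₀ hκ0, mul_assoc]
    refine h2.trans ((mul_le_mul_of_nonneg_right (le_abs_self _) (h.1 _)).trans
      (mul_le_mul_of_nonneg_left (hC a) (abs_nonneg _)))
  · push Not at hx
    refine ⟨1, fun a => ?_⟩
    have : Function.update x i a = Function.update (fun j => (G j).root) i a := by
      funext j
      rcases eq_or_ne j i with rfl | hj
      · simp
      · simp [hj, hx j hj]
    rw [this, one_mul]

/-- The slices through the root of an indecomposable harmonic function on the product are extreme
eigenfunctions. -/
theorem IsJointEigen.slice_mem_extremeEigen [Nonempty ι] {w : ι → ℝ} (hw : ∀ i, 0 ≤ w i)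
    (hw1 : ∑ i, w i = 1) {φ : (∀ j, V j) → ℝ} (h : IsJointEigen G w φ)
    (hφ : φ ∈ (prod G).exFH) (i : ι) :
    (fun a => φ (Function.update (fun j => (G j).root) i a)) ∈ (G i).extremeEigen (w i) := by
  have hE := h.slice G i fun j => (G j).root
  have hroot : φ (Function.update (fun j => (G j).root) i (G i).root) = 1 := by
    rw [Function.update_eq_self]
    exact hφ.2.1
  rcases (hw i).eq_or_lt with hi | hi
  · rw [← hi] at hE ⊢
    exact (G i).mem_extremeEigen_zero hE hroot
  · refine ⟨hE, hroot, fun q hq hle => ?_⟩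
    obtain ⟨ψ, hψ, hψle, hline⟩ := h.exists_lift G hi hq hle
    rw [exFH_eq_extremeEigen] at hφ
    obtain ⟨c, hc⟩ := hφ.2.2 ψ (hψ.isEigen_one G hw1) hψle
    exact ⟨c, fun a => by rw [← hline, hc]⟩

/-- The indecomposable normalized harmonic functions on a product are the tensor products of extreme
eigenfunctions of the factors whose eigenvalues form a point of the closed simplex. -/
theorem mem_exFH_prod_iff [Nonempty ι] (φ : (∀ i, V i) → ℝ) :
    φ ∈ (prod G).exFH ↔ ∃ (w : ι → ℝ) (p : ∀ i, V i → ℝ), (∀ i, 0 ≤ w i) ∧ ∑ i, w i = 1 ∧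
      (∀ i, p i ∈ (G i).extremeEigen (w i)) ∧ φ = tensor p := by
  constructor
  · intro hφ
    obtain ⟨w, hw, hw1, h⟩ := exists_isJointEigen G hφ
    have hp := h.slice_mem_extremeEigen G hw hw1 hφ
    refine ⟨w, _, hw, hw1, hp, funext fun x => ?_⟩
    rw [eq_prod_mul_root G (f := φ) (p := fun i a => φ (Function.update (fun j => (G j).root) i a))
      (fun i x => ?_) x]
    · have h1 : φ (fun i => (G i).root) = 1 := hφ.2.1
      rw [h1, mul_one, tensor]
    · obtain ⟨C, hC⟩ := h.exists_slice_le G i x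
      have := h.slice_eq G (hp i) hC (x i)
      rwa [Function.update_eq_self] at this
  · rintro ⟨w, p, hw, hw1, hp, rfl⟩
    exact tensor_mem_exFH G hw hw1 hp

/-- A tensor product of extreme eigenfunctions determines its factors and their eigenvalues. -/
theorem tensor_injective {w w' : ι → ℝ} {p p' : ∀ i, V i → ℝ}
    (hp : ∀ i, p i ∈ (G i).extremeEigen (w i)) (hp' : ∀ i, p' i ∈ (G i).extremeEigen (w' i))
    (h : tensor p = tensor p') : w = w' ∧ p = p' := by
  have hpp : p = p' := by
    funext i a
    rw [← tensor_update_root G (fun i => (hp i).2.1), h,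
      tensor_update_root G fun i => (hp' i).2.1]
  subst hpp
  refine ⟨funext fun i => ?_, rfl⟩
  have h1 := (hp i).1.2 (G i).root
  rw [(hp' i).1.2, (hp i).2.1, mul_one, mul_one] at h1
  exact h1.symm

end Structure

end BranchingGraph

/-! ### Faces of the simplex and the bijections -/

namespace BranchingGraph

section Face

variable {ι : Type v} [DecidableEq ι] {V : ι → Type u} (G : ∀ i, BranchingGraph (V i))

/-- The weights of a face, extended by zero. -/
def faceWeight (p : FaceData V) (i : ι) : ℝ := if h : i ∈ p.1 then p.2.2 ⟨i, h⟩ else 0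

open Classical in
/-- The factors of `faceFun`: on the face they are `w i ^ rank * φ i`, and off the face they are the
indicator functions of the roots. -/
noncomputable def faceFactor (p : FaceData V) (i : ι) (a : V i) : ℝ :=
  if h : i ∈ p.1 then p.2.2 ⟨i, h⟩ ^ (G i).rank a * p.2.1 ⟨i, h⟩ a
  else if a = (G i).root then 1 else 0

theorem faceWeight_pos_iff {p : FaceData V} (hp : ∀ i, 0 < p.2.2 i) (i : ι) :
    0 < faceWeight p i ↔ i ∈ p.1 := by
  unfold faceWeight
  split_ifs with h
  · simp [h, hp]
  · simp [h]

theorem faceWeight_nonneg {p : FaceData V} (hp : ∀ i, 0 < p.2.2 i) (i : ι) :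
    0 ≤ faceWeight p i := by
  unfold faceWeight
  split_ifs
  · exact (hp _).le
  · exact le_rfl

/-- `faceFactor` has the right shape also off the face, where the eigenvalue is `0` and the indicator
function of the root is the only extreme eigenfunction. -/
theorem faceFactor_mem_extremeEigen {p : FaceData V} (hp : ∀ i, 0 < p.2.2 i)
    (hφ : ∀ i : p.1, p.2.1 i ∈ (G i).exFH) (i : ι) :
    faceFactor G p i ∈ (G i).extremeEigen (faceWeight p i) := by
  by_cases h : i ∈ p.1
  · have := ((G i).pow_rank_mul_mem_extremeEigen_iff (hp ⟨i, h⟩)).2 (hφ ⟨i, h⟩)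
    convert this using 2 with a
    · exact dif_pos h
    · exact dif_pos h
  · have hw : faceWeight p i = 0 := dif_neg h
    rw [hw, extremeEigen_zero_eq, Set.mem_singleton_iff]
    funext a
    exact dif_neg h

variable [Fintype ι]

theorem sum_faceWeight (p : FaceData V) : ∑ i, faceWeight p i = ∑ i, p.2.2 i := by
  have h : ∀ i ∉ p.1, faceWeight p i = 0 := fun i hi => dif_neg hi
  rw [← Finset.sum_subset (Finset.subset_univ p.1) fun i _ => h i, ← Finset.sum_coe_sort]
  exact Finset.sum_congr rfl fun i _ => dif_pos i.2

theorem faceFun_eq_tensor (p : FaceData V) : faceFun G p = tensor (faceFactor G p) := by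
  funext x
  unfold faceFun
  split_ifs with h
  · have h1 : ∀ i ∉ p.1, faceFactor G p i (x i) = 1 := fun i hi => by simp [faceFactor, hi, h i hi]
    rw [tensor, ← Finset.prod_subset (Finset.subset_univ p.1) fun i _ => h1 i,
      ← Finset.prod_coe_sort p.1 fun i => faceFactor G p i (x i)]
    exact Finset.prod_congr rfl fun i _ => by simp [faceFactor]
  · push Not at h
    obtain ⟨j, hj, hx⟩ := h
    refine (Finset.prod_eq_zero (Finset.mem_univ j) ?_).symm
    simp [faceFactor, hj, hx]

theorem injOn_faceFun : Set.InjOn (faceFun G)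
    {p | p.1.Nonempty ∧ (∀ i : p.1, p.2.1 i ∈ (G i).exFH) ∧ p.2.2 ∈ openSimplex p.1} := by
  rintro ⟨I, φ, w⟩ ⟨-, hφ, hw, -⟩ ⟨J, φ', w'⟩ ⟨-, hφ', hw', -⟩ h
  rw [faceFun_eq_tensor, faceFun_eq_tensor] at h
  obtain ⟨hwe, hpe⟩ := tensor_injective G (faceFactor_mem_extremeEigen G hw hφ)
    (faceFactor_mem_extremeEigen G hw' hφ') h
  obtain rfl : I = J := by
    ext i
    rw [← faceWeight_pos_iff (V := V) (p := ⟨I, φ, w⟩) hw, hwe, faceWeight_pos_iff hw']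
  have hww : w = w' := by
    funext i
    have := congrFun hwe i
    simpa [faceWeight] using this
  subst hww
  have hφφ : φ = φ' := by
    funext i a
    have := congrFun (congrFun hpe i) a
    simpa [faceFactor, (pow_pos (hw i) _).ne'] using this
  rw [hφφ]

variable [Nonempty ι]

theorem mapsTo_faceFun : Set.MapsTo (faceFun G)
    {p | p.1.Nonempty ∧ (∀ i : p.1, p.2.1 i ∈ (G i).exFH) ∧ p.2.2 ∈ openSimplex p.1}
    (prod G).exFH := by
  rintro p ⟨-, hφ, hw, hw1⟩
  rw [faceFun_eq_tensor]
  exact tensor_mem_exFH G (faceWeight_nonneg hw) ((sum_faceWeight p).trans hw1)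
    (faceFactor_mem_extremeEigen G hw hφ)

theorem surjOn_faceFun : Set.SurjOn (faceFun G)
    {p | p.1.Nonempty ∧ (∀ i : p.1, p.2.1 i ∈ (G i).exFH) ∧ p.2.2 ∈ openSimplex p.1}
    (prod G).exFH := by
  classical
  intro φ hφ
  obtain ⟨w, p, hw, hw1, hp, rfl⟩ := (mem_exFH_prod_iff G φ).1 hφ
  set I : Finset ι := Finset.univ.filter fun i => 0 < w i with hI
  have hpos : ∀ i : I, 0 < w i := fun i => (Finset.mem_filter.1 i.2).2
  have hzero : ∀ i, i ∉ I → w i = 0 := fun i hi =>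
    le_antisymm (not_lt.1 fun h => hi (Finset.mem_filter.2 ⟨Finset.mem_univ i, h⟩)) (hw i)
  have hpow : ∀ (i : I) (a : V i), w i ^ (G i).rank a * ((w i)⁻¹ ^ (G i).rank a * p i a) = p i a :=
    fun i a => by rw [inv_pow, mul_inv_cancel_left₀ (pow_pos (hpos i) _).ne']
  refine ⟨⟨I, fun i a => (w i)⁻¹ ^ (G i).rank a * p i a, fun i => w i⟩,
    ⟨?_, fun i => ?_, hpos, ?_⟩, ?_⟩
  · by_contra hne
    have hI0 : I = ∅ := Finset.not_nonempty_iff_eq_empty.1 hne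
    exact one_ne_zero (α := ℝ) (hw1.symm.trans (Finset.sum_eq_zero fun i _ =>
      hzero i (hI0 ▸ Finset.notMem_empty i)))
  · have h := hp i
    rw [← funext (hpow i)] at h
    exact ((G i).pow_rank_mul_mem_extremeEigen_iff (hpos i)).1 h
  · rw [Finset.sum_coe_sort I w, Finset.sum_subset (Finset.subset_univ I) fun i _ hi => hzero i hi,
      hw1]
  · rw [faceFun_eq_tensor]
    congr 1
    funext i a
    by_cases hi : i ∈ I
    · exact (dif_pos hi).trans (hpow ⟨i, hi⟩ a)
    · have hpi := hp i
      rw [hzero i hi, extremeEigen_zero_eq, Set.mem_singleton_iff] at hpi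
      rw [hpi]
      exact dif_neg hi

theorem bijOn_prodFun : Set.BijOn (prodFun G)
    {p | (∀ i, p.1 i ∈ (G i).exFHPos) ∧ p.2 ∈ openSimplex ι} (prod G).exFHPos := by
  refine ⟨?_, ?_, ?_⟩
  · rintro ⟨φ, w⟩ ⟨hφ, hw, hw1⟩
    exact ⟨tensor_mem_exFH G (fun i => (hw i).le) hw1 fun i =>
        ((G i).pow_rank_mul_mem_extremeEigen_iff (hw i)).2 (hφ i).1,
      fun x => Finset.prod_pos fun i _ => mul_pos (pow_pos (hw i) _) ((hφ i).2 _)⟩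
  · rintro ⟨φ, w⟩ ⟨hφ, hw, -⟩ ⟨φ', w'⟩ ⟨hφ', hw', -⟩ h
    change tensor (fun i a => w i ^ (G i).rank a * φ i a) =
      tensor (fun i a => w' i ^ (G i).rank a * φ' i a) at h
    obtain ⟨hwe, hpe⟩ := tensor_injective G
      (fun i => ((G i).pow_rank_mul_mem_extremeEigen_iff (hw i)).2 (hφ i).1)
      (fun i => ((G i).pow_rank_mul_mem_extremeEigen_iff (hw' i)).2 (hφ' i).1) h
    have hww : w = w' := hwe
    subst hww
    have hφφ : φ = φ' := by
      funext i a
      exact mul_left_cancel₀ (pow_pos (hw i) _).ne' (congrFun (congrFun hpe i) a)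
    rw [hφφ]
  · rintro φ ⟨hφ, hpos⟩
    obtain ⟨w, p, hw, hw1, hp, rfl⟩ := (mem_exFH_prod_iff G φ).1 hφ
    have hp0 : ∀ i a, 0 < p i a := fun i a => by
      rw [← tensor_update_root G (fun j => (hp j).2.1) i a]
      exact hpos _
    -- If `w i = 0`, then `p i` vanishes off the root.
    have hw0 : ∀ i, 0 < w i := fun i => by
      refine (hw i).lt_of_ne fun hi => ?_
      obtain ⟨a, ha, -⟩ := (G i).exists_up (G i).root
      have hpi := hp i
      rw [← hi] at hpi
      refine (hp0 i a).ne' ((G i).eq_zero_of_isEigen_zero hpi.1 ?_)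
      rintro rfl
      omega
    have hpow : ∀ i (a : V i), w i ^ (G i).rank a * ((w i)⁻¹ ^ (G i).rank a * p i a) = p i a :=
      fun i a => by rw [inv_pow, mul_inv_cancel_left₀ (pow_pos (hw0 i) _).ne']
    refine ⟨⟨fun i a => (w i)⁻¹ ^ (G i).rank a * p i a, w⟩, ⟨fun i => ⟨?_, fun a => ?_⟩, hw0, hw1⟩,
      ?_⟩
    · rw [← (G i).pow_rank_mul_mem_extremeEigen_iff (hw0 i)]
      simp only [hpow]
      exact hp i
    · exact mul_pos (pow_pos (inv_pos.2 (hw0 i)) _) (hp0 i a)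
    · exact congrArg tensor (funext fun i => funext (hpow i))

end Face

end BranchingGraph

theorem mainTheorem4 {n : ℕ} [NeZero n] {V : Fin n → Type u} (G : ∀ i, BranchingGraph (V i)) :
    Set.BijOn (BranchingGraph.prodFun G)
        {p | (∀ i, p.1 i ∈ (G i).exFHPos) ∧ p.2 ∈ openSimplex (Fin n)}
        (BranchingGraph.prod G).exFHPos ∧
      Set.BijOn (BranchingGraph.faceFun G)
        {p | p.1.Nonempty ∧ (∀ i : p.1, p.2.1 i ∈ (G i).exFH) ∧ p.2.2 ∈ openSimplex p.1}
        (BranchingGraph.prod G).exFH :=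
  ⟨BranchingGraph.bijOn_prodFun G, BranchingGraph.mapsTo_faceFun G, BranchingGraph.injOn_faceFun G,
    BranchingGraph.surjOn_faceFun G⟩
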